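/- **Lower bound on the Barthe–Bordenave constant.** For $n\in\mathbb N$ and points $x_1,\dots,x_n,y_1,\dots,y_n\in\mathbb R^d$ and $p>0$ let $$W_p^p(x,y)=\min_{\pi\in S_n}\sum_{i=1}^n |x_i-y_{\pi(i)}|^p ,$$ where $|\cdot|$ is the Euclidean norm. By a theorem of Barthe and Bordenave, for $0<p<d/2$ there is a constant $\beta_p(d)$, depending only on $p$ and $d$, such that for every bounded measurable $\Omega\subset\mathbb R^d$ of positive Lebesgue measure $|\Omega|$ and independent random points $X_1,Y_1,X_2,Y_2,\dots$, each uniformly distributed on $\Omega$, almost surely $$\lim_{n\to\infty} n^{\frac pd-1}\,W_p^p\big((X_i)_{i\le n},(Y_i)_{i\le n}\big)=\beta_p(d)\,|\Omega|^{\frac pd}.$$ Let $\omega_d$ be the volume of the unit ball of $\mathbb R^d$. Then, for $0<p<d/2$, $$\beta_p(d)\;\ge\;\omega_d^{-p/d}\,\Gamma\!\left(1+\frac pd\right).$$ The convergence theorem is not presupposed; the claim is to be read as follows. (i) The bound holds for $\beta_p(d)$ defined as the essential infimum of the lower limit $\liminf_{n\to\infty} n^{p/d-1}W_p^p\big((X_i)_{i\le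 n},(Y_i)_{i\le n}\big)\in[0,\infty]$ for $\Omega=[0,1]^d$ (this is the almost sure limit whenever that limit exists and is deterministic). (ii) The bound holds for every real number $\beta$ in place of $\beta_p(d)$ for which, for some bounded measurable $\Omega$ with $|\Omega|>0$ and some such sequences $X,Y$, one has $n^{p/d-1}W_p^p\big((X_i)_{i\le n},(Y_i)_{i\le n}\big)\to\beta\,|\Omega|^{p/d}$ almost surely. -/

import Mathlib

open MeasureTheory ProbabilityTheory Filter Topology
open scoped ENNReal

/-- The optimal cost `min_π ∑ i, |x i - y (π i)| ^ p` of matching the points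
`x 0, …, x (n - 1)` with the points `y 0, …, y (n - 1)`; the minimum is over all
permutations of `n` elements. -/
noncomputable def matchingCost {d : ℕ} (p : ℝ) (n : ℕ)
    (x y : ℕ → EuclideanSpace ℝ (Fin d)) : ℝ :=
  ⨅ π : Equiv.Perm (Fin n), ∑ i : Fin n, dist (x i) (y (π i)) ^ p

/-- The normalised optimal cost `n ^ (p / d - 1) * min_π ∑ i, |x i - y (π i)| ^ p`. -/
noncomputable def scaledMatchingCost {d : ℕ} (p : ℝ) (n : ℕ)
    (x y : ℕ → EuclideanSpace ℝ (Fin d)) : ℝ :=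
  (n : ℝ) ^ (p / d - 1) * matchingCost p n x y

/-- The unit cube `[0, 1] ^ d` in Euclidean space. -/
def unitCube (d : ℕ) : Set (EuclideanSpace ℝ (Fin d)) :=
  {x | ∀ i, x i ∈ Set.Icc (0 : ℝ) 1}

theorem volume_unitCube (d : ℕ) : volume (unitCube d) = 1 := by
  have h := (EuclideanSpace.volume_preserving_symm_measurableEquiv_toLp (Fin d)).symm
  have h2 : unitCube d = (MeasurableEquiv.toLp 2 (Fin d → ℝ)).symm ⁻¹'
      (Set.Icc (0 : Fin d → ℝ) 1) := by
    ext x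
    simp [unitCube, Pi.le_def, forall_and]
  rw [h2, (EuclideanSpace.volume_preserving_symm_measurableEquiv_toLp (Fin d)).measure_preimage_equiv]
  simp [Real.volume_Icc_pi]

/-- The uniform distribution on the unit cube. -/
noncomputable def cubeUniform (d : ℕ) : Measure (EuclideanSpace ℝ (Fin d)) :=
  cond volume (unitCube d)

instance cubeUniform_isProbabilityMeasure (d : ℕ) : IsProbabilityMeasure (cubeUniform d) :=
  cond_isProbabilityMeasure_of_finite (by simp [volume_unitCube]) (by simp [volume_unitCube])

/-- The law of two independent infinite sequences of independent uniform points of the unit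
cube: coordinate `Sum.inl i` is the point `X i`, coordinate `Sum.inr i` is the point `Y i`. -/
noncomputable def cubeSampleLaw (d : ℕ) : Measure (ℕ ⊕ ℕ → EuclideanSpace ℝ (Fin d)) :=
  Measure.infinitePi fun _ => cubeUniform d

/-- The constant of random Euclidean bipartite matching: the almost sure value of the limit of
`n ^ (p / d - 1) * min_π ∑ i, |X i - Y (π i)| ^ p` for independent uniform points `X i`, `Y i` of
the unit cube (which has volume `1`).  The lower limit and the essential infimum make this a
definition without presupposing convergence; `bipartiteConstant_eq` says that it is the almost
sure limit whenever there is one. -/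
noncomputable def bipartiteConstant (d : ℕ) (p : ℝ) : ℝ≥0∞ :=
  essInf (fun ω => liminf (fun n : ℕ => ENNReal.ofReal
    (scaledMatchingCost p n (fun i => ω (Sum.inl i)) (fun i => ω (Sum.inr i)))) atTop)
    (cubeSampleLaw d)

theorem bipartiteConstant_eq (d : ℕ) (p β : ℝ)
    (h : ∀ᵐ ω ∂(cubeSampleLaw d), Tendsto (fun n : ℕ =>
      scaledMatchingCost p n (fun i => ω (Sum.inl i)) (fun i => ω (Sum.inr i))) atTop (𝓝 β)) :
    bipartiteConstant d p = ENNReal.ofReal β := by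
  have : IsProbabilityMeasure (cubeSampleLaw d) := by
    unfold cubeSampleLaw; infer_instance
  have hae : (fun ω => liminf (fun n : ℕ => ENNReal.ofReal
      (scaledMatchingCost p n (fun i => ω (Sum.inl i)) (fun i => ω (Sum.inr i)))) atTop)
      =ᵐ[cubeSampleLaw d] fun _ => ENNReal.ofReal β := by
    filter_upwards [h] with ω hω
    exact (ENNReal.tendsto_ofReal hω).liminf_eq
  rw [bipartiteConstant, essInf_congr_ae hae, essInf_const _ (IsProbabilityMeasure.ne_zero _)]

/-! Whatever the matching, `X i` is sent no closer than its nearest `Y j`, so the cost is at least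
the sum of the nearest-neighbour distances to the power `p`. With `κ = ω_d / |Ω|`, a ball of radius
`r n^{-1/d}` has uniform measure at most `κ r^d / n`, so it misses `n` independent points with
probability at least `(1 - κ r^d / n)^n → exp(-κ r^d)`. Almost surely this also bounds from below
the limiting fraction of points with no neighbour within that radius (`ae_le_liminf_farCount_div`).
Integrating against `p r^{p-1} dr`, by the layer-cake formula and Fatou's lemma, gives `∫ p r^{p-1}
exp(-κ r^d) dr = κ^{-p/d} Γ(1 + p/d)`.

The almost sure statement is a second-moment argument. Far events of two points with disjoint balls
are nonpositively correlated, and overlapping balls are rare, so the count of far points has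
variance `O(n)`. Chebyshev's inequality and Borel–Cantelli settle `n = k²`; monotonicity of the
count in both sample sizes and in the radius fills the gaps. -/

/-! ### One- and two-point probabilities of having no near neighbour -/

section FarEvents

variable {S E F : Type*} [MeasurableSpace S] {P : Measure S} [IsProbabilityMeasure P]
  [MeasurableSpace E] {μ : Measure E} [IsProbabilityMeasure μ]

/-- For `Z` independent of the iid sample `Y 0, …, Y (N - 1)`, the probability that the whole
sample lies in the random section `G_Z`. -/
theorem measure_forall_mem_eq_lintegral [MeasurableSpace F] {Z : S → F} {Y : ℕ → S → E}
    (hZ : Measurable Z) (hY : ∀ i, Measurable (Y i)) (hYμ : ∀ i, P.map (Y i) = μ)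
    (hYi : iIndepFun Y P) (N : ℕ) (hZY : IndepFun Z (fun s (j : Fin N) => Y j s) P)
    {G : Set (F × E)} (hG : MeasurableSet G) :
    P {s | ∀ j : Fin N, (Z s, Y j s) ∈ G} = ∫⁻ z, μ (Prod.mk z ⁻¹' G) ^ N ∂(P.map Z) := by
  have hYt : Measurable (fun s (j : Fin N) => Y j s) := measurable_pi_lambda _ fun j => hY j
  have hpi : P.map (fun s (j : Fin N) => Y j s) = Measure.pi fun _ => μ := by
    have h : iIndepFun (fun j : Fin N => Y j) P := hYi.precomp Fin.val_injective
    rw [(iIndepFun_iff_map_fun_eq_pi_map (f := fun j : Fin N => Y j)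
      fun j => (hY j).aemeasurable).1 h]
    simp only [hYμ]
  have hmap := hZY.map_prod_eq_prod_map_map hZ.aemeasurable hYt.aemeasurable
  rw [hpi] at hmap
  let A : Set (F × (Fin N → E)) := {q | ∀ j, (q.1, q.2 j) ∈ G}
  have hA : MeasurableSet A := by
    have : A = ⋂ j, (fun q : F × (Fin N → E) => (q.1, q.2 j)) ⁻¹' G := by
      ext q; simp [A]
    rw [this]
    refine MeasurableSet.iInter fun j => hG.preimage ?_
    fun_prop
  have hm : IsProbabilityMeasure (P.map Z) := Measure.isProbabilityMeasure_map hZ.aemeasurable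
  calc P {s | ∀ j : Fin N, (Z s, Y j s) ∈ G}
      = P.map (fun s => (Z s, fun j : Fin N => Y j s)) A := by
        rw [Measure.map_apply (hZ.prodMk hYt) hA]; rfl
    _ = ∫⁻ z, (Measure.pi fun _ : Fin N => μ) (Prod.mk z ⁻¹' A) ∂(P.map Z) := by
        rw [hmap, Measure.prod_apply hA]
    _ = _ := by
        refine lintegral_congr fun z => ?_
        have : Prod.mk z ⁻¹' A = Set.univ.pi fun _ : Fin N => Prod.mk z ⁻¹' G := by
          ext y; simp [A]
        rw [this, Measure.pi_pi]
        simp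

/-- The event that `X i` is at distance more than `ρ` from each of `Y 0, …, Y (N - 1)`. -/
def farEvent [Dist E] (X Y : ℕ → S → E) (N : ℕ) (ρ : ℝ) (i : ℕ) : Set S :=
  {s | ∀ j : Fin N, ρ < dist (X i s) (Y j s)}

variable [PseudoMetricSpace E] [SecondCountableTopology E] [BorelSpace E]

omit [IsProbabilityMeasure P] in
theorem measurableSet_farEvent {X Y : ℕ → S → E} (hX : ∀ i, Measurable (X i))
    (hY : ∀ i, Measurable (Y i)) (N : ℕ) (ρ : ℝ) (i : ℕ) :
    MeasurableSet (farEvent X Y N ρ i) := by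
  have : farEvent X Y N ρ i = ⋂ j : Fin N, {s | ρ < dist (X i s) (Y j s)} := by
    ext s; simp [farEvent]
  rw [this]
  exact MeasurableSet.iInter fun j =>
    measurableSet_lt measurable_const ((hX i).dist (hY j))

theorem measure_farEvent {X Y : ℕ → S → E} (hX : ∀ i, Measurable (X i))
    (hY : ∀ i, Measurable (Y i)) (hXμ : ∀ i, P.map (X i) = μ) (hYμ : ∀ i, P.map (Y i) = μ)
    (hind : iIndepFun (Sum.elim X Y) P) (N : ℕ) (ρ : ℝ) (i : ℕ) :
    P (farEvent X Y N ρ i) = ∫⁻ x, μ {y | ρ < dist x y} ^ N ∂μ := by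
  have hm : ∀ k, Measurable (Sum.elim X Y k) := by rintro (k | k); exacts [hX k, hY k]
  have hYi : iIndepFun Y P := hind.precomp (g := Sum.inr) Sum.inr_injective
  have h := hind.indepFun_finset {Sum.inl i} ((Finset.range N).map ⟨Sum.inr, Sum.inr_injective⟩)
    (by simp) hm
  have h' : IndepFun (X i) (fun s (j : Fin N) => Y j s) P :=
    h.comp (φ := fun f : ({Sum.inl i} : Finset (ℕ ⊕ ℕ)) → E => f ⟨Sum.inl i, by simp⟩)
    (ψ := fun (f : (Finset.range N).map ⟨Sum.inr, Sum.inr_injective⟩ → E) (j : Fin N) =>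
      f ⟨Sum.inr j, by simp⟩) (measurable_pi_apply _) (by fun_prop)
  have hG : MeasurableSet {q : E × E | ρ < dist q.1 q.2} :=
    measurableSet_lt measurable_const (by fun_prop)
  rw [← hXμ i]
  simpa [hXμ i, farEvent] using measure_forall_mem_eq_lintegral (hX i) hY hYμ hYi N h' hG

theorem measure_farEvent_inter {X Y : ℕ → S → E} (hX : ∀ i, Measurable (X i))
    (hY : ∀ i, Measurable (Y i)) (hXμ : ∀ i, P.map (X i) = μ) (hYμ : ∀ i, P.map (Y i) = μ)
    (hind : iIndepFun (Sum.elim X Y) P) (N : ℕ) (ρ : ℝ) {i k : ℕ} (hik : i ≠ k) :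
    P (farEvent X Y N ρ i ∩ farEvent X Y N ρ k) =
      ∫⁻ x, ∫⁻ x', μ {y | ρ < dist x y ∧ ρ < dist x' y} ^ N ∂μ ∂μ := by
  have hm : ∀ k, Measurable (Sum.elim X Y k) := by rintro (k | k); exacts [hX k, hY k]
  have hYi : iIndepFun Y P := hind.precomp (g := Sum.inr) Sum.inr_injective
  have h := hind.indepFun_finset {Sum.inl i, Sum.inl k}
    ((Finset.range N).map ⟨Sum.inr, Sum.inr_injective⟩)
    (by simp) hm
  have h' := h.comp (φ := fun f : ({Sum.inl i, Sum.inl k} : Finset (ℕ ⊕ ℕ)) → E =>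
      (f ⟨Sum.inl i, by simp⟩, f ⟨Sum.inl k, by simp⟩))
    (ψ := fun (f : (Finset.range N).map ⟨Sum.inr, Sum.inr_injective⟩ → E) (j : Fin N) =>
      f ⟨Sum.inr j, by simp⟩) (by fun_prop) (by fun_prop)
  have hG1 : MeasurableSet {q : (E × E) × E | ρ < dist q.1.1 q.2} :=
    measurableSet_lt measurable_const (by fun_prop)
  have hG2 : MeasurableSet {q : (E × E) × E | ρ < dist q.1.2 q.2} :=
    measurableSet_lt measurable_const (by fun_prop)
  have hXX : P.map (fun s => (X i s, X k s)) = μ.prod μ := by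
    have h2 : IndepFun (X i) (X k) P :=
      hind.indepFun (i := Sum.inl i) (j := Sum.inl k) (by simpa using hik)
    rw [h2.map_prod_eq_prod_map_map (hX i).aemeasurable (hX k).aemeasurable, hXμ, hXμ]
  have key := measure_forall_mem_eq_lintegral ((hX i).prodMk (hX k)) hY hYμ hYi N h'
    (hG1.inter hG2)
  rw [hXX] at key
  rw [← lintegral_prod (fun z : E × E => μ {y | ρ < dist z.1 y ∧ ρ < dist z.2 y} ^ N)]
  · convert key using 2
    ext s
    simp [farEvent, forall_and]
    rfl
  · exact ((measurable_measure_prodMk_left (hG1.inter hG2)).pow_const N).aemeasurable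

omit [MeasurableSpace E] [SecondCountableTopology E] [BorelSpace E] in
theorem setOf_lt_dist_eq_compl (ρ : ℝ) (x : E) :
    {y | ρ < dist x y} = (Metric.closedBall x ρ)ᶜ := by
  ext y; simp [dist_comm]

omit [SecondCountableTopology E] in
-- The two balls are disjoint, so with masses `a`, `b` this is `1 - a - b ≤ (1 - a)(1 - b)`.
theorem measure_far_far_le_mul {ρ : ℝ} {x x' : E} (h : 2 * ρ < dist x x') :
    μ {y | ρ < dist x y ∧ ρ < dist x' y} ≤ μ {y | ρ < dist x y} * μ {y | ρ < dist x' y} := by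
  have hd : Disjoint (Metric.closedBall x ρ) (Metric.closedBall x' ρ) :=
    Metric.closedBall_disjoint_closedBall (by linarith)
  have he : {y | ρ < dist x y ∧ ρ < dist x' y}
      = (Metric.closedBall x ρ ∪ Metric.closedBall x' ρ)ᶜ := by
    ext y; simp [dist_comm]
  have hb := Metric.isClosed_closedBall (x := x) (ε := ρ) |>.measurableSet
  have hb' := Metric.isClosed_closedBall (x := x') (ε := ρ) |>.measurableSet
  rw [he, setOf_lt_dist_eq_compl, setOf_lt_dist_eq_compl]
  rw [← ofReal_measureReal, ← ofReal_measureReal (s := (Metric.closedBall x ρ)ᶜ),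
    ← ofReal_measureReal (s := (Metric.closedBall x' ρ)ᶜ),
    ← ENNReal.ofReal_mul measureReal_nonneg]
  apply ENNReal.ofReal_le_ofReal
  rw [probReal_compl_eq_one_sub (hb.union hb'), probReal_compl_eq_one_sub hb,
    probReal_compl_eq_one_sub hb', measureReal_union hd hb']
  nlinarith [measureReal_nonneg (μ := μ) (s := Metric.closedBall x ρ),
    measureReal_nonneg (μ := μ) (s := Metric.closedBall x' ρ)]

/-- Condition on the two centres: if they are more than `2ρ` apart the integrand is bounded by a
product, and the remaining pairs have probability at most `δ`. -/
theorem measure_farEvent_inter_le {X Y : ℕ → S → E} (hX : ∀ i, Measurable (X i))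
    (hY : ∀ i, Measurable (Y i)) (hXμ : ∀ i, P.map (X i) = μ) (hYμ : ∀ i, P.map (Y i) = μ)
    (hind : iIndepFun (Sum.elim X Y) P) (N : ℕ) {ρ : ℝ} {i k : ℕ} (hik : i ≠ k) {δ : ℝ≥0∞}
    (hδ : ∀ x, μ (Metric.closedBall x (2 * ρ)) ≤ δ) :
    P (farEvent X Y N ρ i ∩ farEvent X Y N ρ k) ≤
      P (farEvent X Y N ρ i) * P (farEvent X Y N ρ k) + δ := by
  rw [measure_farEvent_inter hX hY hXμ hYμ hind N ρ hik, measure_farEvent hX hY hXμ hYμ hind,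
    measure_farEvent hX hY hXμ hYμ hind]
  have hmeas : Measurable fun x : E => μ {y | ρ < dist x y} ^ N := by
    have hG : MeasurableSet {q : E × E | ρ < dist q.1 q.2} :=
      measurableSet_lt measurable_const (by fun_prop)
    exact (measurable_measure_prodMk_left hG).pow_const N
  have hpt : ∀ x x' : E, μ {y | ρ < dist x y ∧ ρ < dist x' y} ^ N ≤
      μ {y | ρ < dist x y} ^ N * μ {y | ρ < dist x' y} ^ N +
        (Metric.closedBall x (2 * ρ)).indicator 1 x' := by
    intro x x'
    by_cases h : x' ∈ Metric.closedBall x (2 * ρ)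
    · rw [Set.indicator_of_mem h]
      exact le_add_left (pow_le_one₀ zero_le prob_le_one)
    · rw [← mul_pow]
      refine le_add_right (pow_le_pow_left₀ zero_le (measure_far_far_le_mul ?_) N)
      simpa [dist_comm] using h
  calc ∫⁻ x, ∫⁻ x', μ {y | ρ < dist x y ∧ ρ < dist x' y} ^ N ∂μ ∂μ
      ≤ ∫⁻ x, (μ {y | ρ < dist x y} ^ N * (∫⁻ x', μ {y | ρ < dist x' y} ^ N ∂μ) + δ) ∂μ := by
        refine lintegral_mono fun x => ?_
        refine (lintegral_mono (hpt x)).trans ?_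
        rw [lintegral_add_left (hmeas.const_mul _), lintegral_const_mul _ hmeas,
          lintegral_indicator_one Metric.isClosed_closedBall.measurableSet]
        gcongr
        exact hδ x
    _ = _ := by
        rw [lintegral_add_right _ measurable_const, lintegral_mul_const _ hmeas]
        simp

theorem le_measureReal_farEvent {X Y : ℕ → S → E} (hX : ∀ i, Measurable (X i))
    (hY : ∀ i, Measurable (Y i)) (hXμ : ∀ i, P.map (X i) = μ) (hYμ : ∀ i, P.map (Y i) = μ)
    (hind : iIndepFun (Sum.elim X Y) P) (N : ℕ) {ρ : ℝ} (i : ℕ) {a : ℝ} (ha : a ≤ 1)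
    (hδ : ∀ x, μ.real (Metric.closedBall x ρ) ≤ a) :
    (1 - a) ^ N ≤ P.real (farEvent X Y N ρ i) := by
  have h : ENNReal.ofReal ((1 - a) ^ N) ≤ P (farEvent X Y N ρ i) := by
    rw [measure_farEvent hX hY hXμ hYμ hind]
    calc ENNReal.ofReal ((1 - a) ^ N) = ∫⁻ _, ENNReal.ofReal ((1 - a) ^ N) ∂μ := by simp
      _ ≤ _ := by
        refine lintegral_mono fun x => ?_
        rw [ENNReal.ofReal_pow (by linarith), setOf_lt_dist_eq_compl, ← ofReal_measureReal]
        gcongr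
        rw [probReal_compl_eq_one_sub Metric.isClosed_closedBall.measurableSet]
        linarith [hδ x]
  exact (ENNReal.ofReal_le_iff_le_toReal (measure_ne_top _ _)).1 h

end FarEvents

/-! ### Second moment of the number of far points -/

section FarCount

open Classical in
/-- The number of points among `x 0, …, x (m - 1)` at distance more than `ρ` from each of
`y 0, …, y (N - 1)`. -/
noncomputable def farCount {E : Type*} [Dist E] (x y : ℕ → E) (m N : ℕ) (ρ : ℝ) : ℕ :=
  ((Finset.range m).filter fun i => ∀ j : Fin N, ρ < dist (x i) (y j)).card

/-- This monotonicity is what allows passing from squares to all sample sizes. -/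
theorem farCount_mono {E : Type*} [Dist E] (x y : ℕ → E) {m m' N N' : ℕ} {ρ ρ' : ℝ}
    (hm : m ≤ m') (hN : N' ≤ N) (hρ : ρ' ≤ ρ) : farCount x y m N ρ ≤ farCount x y m' N' ρ' := by
  refine Finset.card_le_card fun i hi => ?_
  simp only [Finset.mem_filter, Finset.mem_range] at hi ⊢
  exact ⟨hi.1.trans_le hm, fun j => hρ.trans_lt (hi.2 (Fin.castLE hN j))⟩

variable {S E : Type*} [MeasurableSpace S] {P : Measure S} [IsProbabilityMeasure P]
  [MeasurableSpace E] {μ : Measure E} [IsProbabilityMeasure μ]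
  [PseudoMetricSpace E] [SecondCountableTopology E] [BorelSpace E]

omit [MeasurableSpace S] [MeasurableSpace E] [SecondCountableTopology E] [BorelSpace E] in
theorem farCount_eq_sum_indicator (X Y : ℕ → S → E) (m N : ℕ) (ρ : ℝ) (s : S) :
    (farCount (fun i => X i s) (fun i => Y i s) m N ρ : ℝ) =
      (∑ i ∈ Finset.range m, (farEvent X Y N ρ i).indicator (fun _ => (1 : ℝ))) s := by
  simp [farCount, Finset.sum_apply, Set.indicator_apply, farEvent, Finset.sum_boole]

/-- The `m` diagonal covariances supply the term `m`; `δ` is charged to all `m ^ 2` pairs. -/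
theorem variance_sum_farEvent_le {X Y : ℕ → S → E} (hX : ∀ i, Measurable (X i))
    (hY : ∀ i, Measurable (Y i)) (hXμ : ∀ i, P.map (X i) = μ) (hYμ : ∀ i, P.map (Y i) = μ)
    (hind : iIndepFun (Sum.elim X Y) P) (m N : ℕ) {ρ δ : ℝ} (hδ0 : 0 ≤ δ)
    (hδ : ∀ x, μ.real (Metric.closedBall x (2 * ρ)) ≤ δ) :
    variance (∑ i ∈ Finset.range m, (farEvent X Y N ρ i).indicator (fun _ => (1 : ℝ))) P ≤
      m + m ^ 2 * δ := by
  have hA := measurableSet_farEvent hX hY N ρ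
  have hL : ∀ i, MemLp ((farEvent X Y N ρ i).indicator (fun _ => (1 : ℝ))) 2 P :=
    fun i => memLp_indicator_const 2 (hA i) 1 (Or.inr (measure_ne_top _ _))
  rw [variance_sum' fun i _ => hL i]
  have hcov : ∀ i k, cov[(farEvent X Y N ρ i).indicator (fun _ => (1 : ℝ)),
      (farEvent X Y N ρ k).indicator (fun _ => (1 : ℝ)); P] ≤ (if i = k then 1 else 0) + δ := by
    intro i k
    have hprod : (farEvent X Y N ρ i).indicator (fun _ => (1 : ℝ)) *
        (farEvent X Y N ρ k).indicator (fun _ => (1 : ℝ)) =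
        (farEvent X Y N ρ i ∩ farEvent X Y N ρ k).indicator (fun _ => (1 : ℝ)) := by
      ext s; rw [Pi.mul_apply, ← Set.inter_indicator_mul]; simp
    rw [covariance_eq_sub (hL i) (hL k), hprod, integral_indicator_const _ (hA i),
      integral_indicator_const _ (hA k), integral_indicator_const _ ((hA i).inter (hA k))]
    simp only [smul_eq_mul, mul_one]
    split_ifs with h
    · have h1 := measureReal_le_one (μ := P) (s := farEvent X Y N ρ i ∩ farEvent X Y N ρ k)
      have h2 := mul_nonneg (measureReal_nonneg (μ := P) (s := farEvent X Y N ρ i))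
        (measureReal_nonneg (μ := P) (s := farEvent X Y N ρ k))
      linarith
    · have h1 := measure_farEvent_inter_le hX hY hXμ hYμ hind N h (ρ := ρ)
        (δ := ENNReal.ofReal δ) fun x => by
          rw [← ofReal_measureReal]; exact ENNReal.ofReal_le_ofReal (hδ x)
      have h2 := ENNReal.toReal_mono (by finiteness) h1
      rw [ENNReal.toReal_add (by finiteness) (by finiteness), ENNReal.toReal_mul,
        ENNReal.toReal_ofReal hδ0] at h2
      simp only [measureReal_def]
      linarith
  calc _ ≤ ∑ i ∈ Finset.range m, ∑ k ∈ Finset.range m, ((if i = k then 1 else 0) + δ) :=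
        Finset.sum_le_sum fun i _ => Finset.sum_le_sum fun k _ => hcov i k
    _ = m + m ^ 2 * δ := by
        simp only [Finset.sum_add_distrib, Finset.sum_ite_eq, Finset.sum_const, Finset.card_range,
          nsmul_eq_mul]
        rw [Finset.sum_congr rfl fun i hi => if_pos hi]
        simp
        ring

theorem measure_farCount_le {X Y : ℕ → S → E} (hX : ∀ i, Measurable (X i))
    (hY : ∀ i, Measurable (Y i)) (hXμ : ∀ i, P.map (X i) = μ) (hYμ : ∀ i, P.map (Y i) = μ)
    (hind : iIndepFun (Sum.elim X Y) P) {m : ℕ} (hm : 0 < m) (N : ℕ) {ρ δ a c ε : ℝ} (hδ0 : 0 ≤ δ)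
    (hδ : ∀ x, μ.real (Metric.closedBall x (2 * ρ)) ≤ δ) (ha : a ≤ 1)
    (haρ : ∀ x, μ.real (Metric.closedBall x ρ) ≤ a) (hε : 0 < ε) (hc : c + ε ≤ (1 - a) ^ N) :
    P {s | (farCount (fun i => X i s) (fun i => Y i s) m N ρ : ℝ) ≤ c * m} ≤
      ENNReal.ofReal ((m + m ^ 2 * δ) / (m * ε) ^ 2) := by
  have hA := measurableSet_farEvent hX hY N ρ
  have hL : ∀ i, MemLp ((farEvent X Y N ρ i).indicator (fun _ => (1 : ℝ))) 2 P :=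
    fun i => memLp_indicator_const 2 (hA i) 1 (Or.inr (measure_ne_top _ _))
  set f := ∑ i ∈ Finset.range m, (farEvent X Y N ρ i).indicator (fun _ => (1 : ℝ)) with hf
  have hfL : MemLp f 2 P := memLp_finsetSum' _ fun i _ => hL i
  have hm' : (0 : ℝ) < m := by exact_mod_cast hm
  have hmean : (c + ε) * m ≤ ∫ s, f s ∂P := by
    simp only [hf, Finset.sum_apply]
    rw [integral_finsetSum _ fun i _ => (hL i).integrable (by norm_num)]
    calc (c + ε) * m = ∑ i ∈ Finset.range m, (c + ε) := by
          rw [Finset.sum_const, Finset.card_range, nsmul_eq_mul, mul_comm]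
      _ ≤ _ := by
        refine Finset.sum_le_sum fun i _ => ?_
        rw [integral_indicator_const _ (hA i), smul_eq_mul, mul_one]
        exact hc.trans (le_measureReal_farEvent hX hY hXμ hYμ hind N i ha haρ)
  -- The mean is at least `(c + ε) * m`, so a count of at most `c * m` deviates by at least `m * ε`.
  calc _ ≤ P {s | m * ε ≤ |f s - ∫ s, f s ∂P|} := by
        refine measure_mono fun s hs => ?_
        simp only [Set.mem_ofPred_eq] at hs ⊢
        rw [farCount_eq_sum_indicator, ← hf] at hs
        rw [abs_sub_comm]
        exact le_trans (by linarith) (le_abs_self _)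
    _ ≤ _ := meas_ge_le_variance_div_sq hfL (by positivity)
    _ ≤ _ := by
        gcongr
        exact variance_sum_farEvent_le hX hY hXμ hYμ hind m N hδ0 hδ

end FarCount

/-! ### Almost sure lower bounds: squares, then all sample sizes -/

theorem tendsto_one_sub_div_sq_pow_mul (a : ℝ) :
    Tendsto (fun k : ℕ => (1 + -a / (k ^ 2 : ℕ)) ^ (k ^ 2) *
      (1 + (2 * k + 1 : ℕ) * (-a / (k ^ 2 : ℕ)))) atTop (𝓝 (Real.exp (-a))) := by
  have h1 := (Real.tendsto_one_add_div_pow_exp (-a)).comp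
    (tendsto_pow_atTop (α := ℕ) two_ne_zero)
  have h2 : Tendsto (fun k : ℕ => (1 + (2 * k + 1 : ℕ) * (-a / (k ^ 2 : ℕ)) : ℝ)) atTop
      (𝓝 (1 + 0)) := by
    refine tendsto_const_nhds.add ?_
    have hk : Tendsto (fun k : ℕ => (k : ℝ)⁻¹) atTop (𝓝 0) := tendsto_inv_atTop_nhds_zero_nat
    have h3 : Tendsto (fun k : ℕ => -a * (2 * (k : ℝ)⁻¹ + (k : ℝ)⁻¹ * (k : ℝ)⁻¹)) atTop
        (𝓝 (-a * (2 * 0 + 0 * 0))) := ((hk.const_mul 2).add (hk.mul hk)).const_mul _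
    simp only [mul_zero, add_zero] at h3
    refine h3.congr' ?_
    filter_upwards [eventually_gt_atTop 0] with k hk
    have : (k : ℝ) ≠ 0 := by positivity
    push_cast
    field_simp
  simpa using h1.mul h2

/-- The radius is scaled to `k ^ 2` points but must avoid `(k + 1) ^ 2` of them. By Bernoulli's
inequality the `2 * k + 1` extra factors cost only `1 - O(1/k)`. -/
theorem eventually_lt_one_sub_div_sq_pow {a c : ℝ} (hc : c < Real.exp (-a)) :
    ∀ᶠ k : ℕ in atTop, c < (1 - a / (k ^ 2 : ℕ)) ^ ((k + 1) ^ 2) := by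
  have hbig : ∀ᶠ k : ℕ in atTop, a ≤ ((k ^ 2 : ℕ) : ℝ) :=
    (tendsto_natCast_atTop_atTop.comp (tendsto_pow_atTop (α := ℕ) two_ne_zero)).eventually_ge_atTop a
  filter_upwards [(tendsto_one_sub_div_sq_pow_mul a).eventually_const_lt hc, hbig,
    eventually_gt_atTop 0] with k h1 h2 h3
  have hk : (0 : ℝ) < (k ^ 2 : ℕ) := by positivity
  have h4 : -1 ≤ -a / (k ^ 2 : ℕ) := by rw [le_div_iff₀ hk]; linarith
  refine h1.trans_le ?_
  have h5 : (1 - a / (k ^ 2 : ℕ)) = 1 + -a / (k ^ 2 : ℕ) := by ring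
  rw [h5, show (k + 1) ^ 2 = k ^ 2 + (2 * k + 1) by ring, pow_add]
  exact mul_le_mul_of_nonneg_left (one_add_mul_le_pow (by linarith) _)
    (pow_nonneg (by linarith) _)

section AlmostSure

variable {S E : Type*} [MeasurableSpace S] {P : Measure S} [IsProbabilityMeasure P]
  [MeasurableSpace E] {μ : Measure E} [IsProbabilityMeasure μ]
  [PseudoMetricSpace E] [SecondCountableTopology E] [BorelSpace E]

theorem mul_rpow_neg_inv_pow {d : ℕ} (hd : d ≠ 0) (r : ℝ) {t : ℝ} (ht : 0 ≤ t) :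
    (r * t ^ (-(1 / d : ℝ))) ^ d = r ^ d / t := by
  rw [mul_pow, ← Real.rpow_mul_natCast ht, neg_mul, one_div, inv_mul_cancel₀ (by exact_mod_cast hd),
    Real.rpow_neg_one, div_eq_mul_inv]

/-- Borel–Cantelli. The `X` sample has size `k ^ 2` and the `Y` sample size `(k + 1) ^ 2`, the worst
case for every `n` between these squares. -/
theorem ae_eventually_lt_farCount_sq {d : ℕ} (hd : d ≠ 0) {κ : ℝ} (hκ : 0 ≤ κ)
    (hμ : ∀ x ρ, 0 ≤ ρ → μ.real (Metric.closedBall x ρ) ≤ κ * ρ ^ d)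
    {X Y : ℕ → S → E} (hX : ∀ i, Measurable (X i))
    (hY : ∀ i, Measurable (Y i)) (hXμ : ∀ i, P.map (X i) = μ) (hYμ : ∀ i, P.map (Y i) = μ)
    (hind : iIndepFun (Sum.elim X Y) P) {r c : ℝ} (hr : 0 < r)
    (hc : c < Real.exp (-(κ * r ^ d))) :
    ∀ᵐ s ∂P, ∀ᶠ k : ℕ in atTop, c * (k ^ 2 : ℕ) <
      farCount (fun i => X i s) (fun i => Y i s) (k ^ 2) ((k + 1) ^ 2)
        (r * ((k ^ 2 : ℕ) : ℝ) ^ (-(1 / d : ℝ))) := by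
  obtain ⟨c', hcc', hc'⟩ := exists_between hc
  set ε := c' - c with hεd
  have hε : 0 < ε := by linarith
  set a := κ * r ^ d with ha
  have ha0 : 0 ≤ a := by positivity
  set C := κ * (2 ^ d * r ^ d) with hC
  have hC0 : 0 ≤ C := by positivity
  have hbig : ∀ᶠ k : ℕ in atTop, a ≤ ((k ^ 2 : ℕ) : ℝ) :=
    (tendsto_natCast_atTop_atTop.comp (tendsto_pow_atTop (α := ℕ) two_ne_zero)).eventually_ge_atTop a
  obtain ⟨K, hK⟩ := eventually_atTop.1
    ((eventually_lt_one_sub_div_sq_pow hc').and (hbig.and (eventually_gt_atTop 0)))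
  let B : ℕ → Set S := fun k => {s | (farCount (fun i => X i s) (fun i => Y i s) (k ^ 2)
    ((k + 1) ^ 2) (r * ((k ^ 2 : ℕ) : ℝ) ^ (-(1 / d : ℝ))) : ℝ) ≤ c * (k ^ 2 : ℕ)}
  -- With `m = k ^ 2` and `δ = C / m`, Chebyshev's bound `(m + m ^ 2 * δ) / (m * ε) ^ 2` is `(1 + C)
  -- / (ε ^ 2 * m)`, summable in `k`.
  have hB : ∀ k, K ≤ k → P (B k) ≤ ENNReal.ofReal ((1 + C) / ε ^ 2 * (1 / (k : ℝ) ^ 2)) := by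
    intro k hk
    obtain ⟨h1, h2, h3⟩ := hK k hk
    have hk0 : (0 : ℝ) < (k ^ 2 : ℕ) := by positivity
    refine (measure_farCount_le hX hY hXμ hYμ hind (m := k ^ 2) (by positivity) ((k + 1) ^ 2)
      (δ := C / (k ^ 2 : ℕ)) (a := a / (k ^ 2 : ℕ)) (ε := ε) (by positivity)
      (fun x => ?_) ((div_le_one hk0).2 h2) (fun x => ?_) hε ?_).trans ?_
    · refine (hμ _ _ (by positivity)).trans_eq ?_
      rw [mul_pow, mul_rpow_neg_inv_pow hd r hk0.le, hC]
      ring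
    · refine (hμ _ _ (by positivity)).trans_eq ?_
      rw [mul_rpow_neg_inv_pow hd r hk0.le, ha]
      ring
    · rw [hεd]; linarith
    · refine ENNReal.ofReal_le_ofReal (le_of_eq ?_)
      have : (k : ℝ) ≠ 0 := by positivity
      push_cast
      field_simp
  have hsum : ∑' k, P (B (k + K)) ≠ ∞ := by
    have hs : Summable fun k : ℕ => (1 + C) / ε ^ 2 * (1 / ((k + K : ℕ) : ℝ) ^ 2) :=
      ((summable_nat_add_iff K).2 (Real.summable_one_div_nat_pow.2 one_lt_two)).mul_left _
    refine ne_top_of_le_ne_top hs.tsum_ofReal_ne_top ?_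
    exact ENNReal.tsum_le_tsum fun k => hB _ (Nat.le_add_left _ _)
  filter_upwards [ae_eventually_notMem hsum] with s hs
  obtain ⟨K', hK'⟩ := eventually_atTop.1 hs
  filter_upwards [eventually_ge_atTop (K' + K)] with k hk
  have hk := hK' (k - K) (by omega)
  rw [Nat.sub_add_cancel (by omega)] at hk
  simpa [B] using hk

/-- Consecutive squares have ratio tending to `1`, so the loss is absorbed by the gap between `c`
and `c'`. -/
theorem eventually_mul_lt_of_sq {u : ℕ → ℕ} {v : ℕ → ℝ} {c c' : ℝ} (hc : 0 ≤ c) (hcc' : c < c')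
    (hv : ∀ᶠ k : ℕ in atTop, c' * (k ^ 2 : ℕ) < v k)
    (huv : ∀ n, v n.sqrt ≤ u n) : ∀ᶠ n : ℕ in atTop, c * n < u n := by
  have hsq : Tendsto Nat.sqrt atTop atTop :=
    tendsto_atTop_atTop.2 fun b => ⟨b * b, fun n hn => Nat.le_sqrt.2 hn⟩
  have h1 : ∀ᶠ k : ℕ in atTop, c * ((k + 1) ^ 2 : ℕ) ≤ c' * (k ^ 2 : ℕ) := by
    have hk : Tendsto (fun k : ℕ => (k : ℝ)⁻¹) atTop (𝓝 0) := tendsto_inv_atTop_nhds_zero_nat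
    have h3 : Tendsto (fun k : ℕ => c * (1 + (k : ℝ)⁻¹) ^ 2) atTop (𝓝 (c * (1 + 0) ^ 2)) :=
      ((hk.const_add 1).pow 2).const_mul c
    filter_upwards [h3.eventually_lt_const (show c * (1 + 0) ^ 2 < c' by simpa using hcc'),
      eventually_gt_atTop 0] with k h4 h5
    have h6 : (0 : ℝ) < k := by exact_mod_cast h5
    have h7 := mul_le_mul_of_nonneg_right h4.le (sq_nonneg (k : ℝ))
    refine le_trans (le_of_eq ?_) (h7.trans_eq ?_)
    · push_cast; field_simp
    · push_cast; ring
  filter_upwards [hsq.eventually hv, hsq.eventually h1] with n h2 h3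
  have h4 : (n : ℝ) ≤ ((n.sqrt + 1) ^ 2 : ℕ) := by
    exact_mod_cast (Nat.lt_succ_sqrt' n).le
  calc c * n ≤ c * ((n.sqrt + 1) ^ 2 : ℕ) := by gcongr
    _ < v n.sqrt := h3.trans_lt h2
    _ ≤ u n := huv n

theorem ae_eventually_lt_farCount {d : ℕ} (hd : d ≠ 0) {κ : ℝ} (hκ : 0 ≤ κ)
    (hμ : ∀ x ρ, 0 ≤ ρ → μ.real (Metric.closedBall x ρ) ≤ κ * ρ ^ d)
    {X Y : ℕ → S → E} (hX : ∀ i, Measurable (X i))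
    (hY : ∀ i, Measurable (Y i)) (hXμ : ∀ i, P.map (X i) = μ) (hYμ : ∀ i, P.map (Y i) = μ)
    (hind : iIndepFun (Sum.elim X Y) P) {r c : ℝ} (hr : 0 < r) (hc0 : 0 ≤ c)
    (hc : c < Real.exp (-(κ * r ^ d))) :
    ∀ᵐ s ∂P, ∀ᶠ n : ℕ in atTop, c * n <
      farCount (fun i => X i s) (fun i => Y i s) n n (r * (n : ℝ) ^ (-(1 / d : ℝ))) := by
  obtain ⟨c', hcc', hc'⟩ := exists_between hc
  filter_upwards [ae_eventually_lt_farCount_sq hd hκ hμ hX hY hXμ hYμ hind hr hc'] with s hs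
  have hs' := hs.and (eventually_gt_atTop 0)
  -- The value at `k = 0` is set to `0` because comparing radii through a negative power needs a
  -- positive base.
  refine eventually_mul_lt_of_sq (v := fun k => if k = 0 then 0 else
    (farCount (fun i => X i s) (fun i => Y i s) (k ^ 2) ((k + 1) ^ 2)
        (r * ((k ^ 2 : ℕ) : ℝ) ^ (-(1 / d : ℝ))) : ℝ)) hc0 hcc' ?_ fun n => ?_
  · filter_upwards [hs'] with k hk
    rw [if_neg hk.2.ne']
    exact hk.1
  · split_ifs with h
    · positivity
    · have h1 : n.sqrt ^ 2 ≤ n := Nat.sqrt_le' n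
      have h2 : (0 : ℝ) < (n.sqrt ^ 2 : ℕ) := by positivity
      exact_mod_cast farCount_mono _ _ h1 (Nat.lt_succ_sqrt' n).le
        (mul_le_mul_of_nonneg_left (Real.rpow_le_rpow_of_nonpos h2 (by exact_mod_cast h1)
          (by simp)) hr.le)

theorem ae_le_liminf_farCount_div {d : ℕ} (hd : d ≠ 0) {κ : ℝ} (hκ : 0 ≤ κ)
    (hμ : ∀ x ρ, 0 ≤ ρ → μ.real (Metric.closedBall x ρ) ≤ κ * ρ ^ d)
    {X Y : ℕ → S → E} (hX : ∀ i, Measurable (X i))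
    (hY : ∀ i, Measurable (Y i)) (hXμ : ∀ i, P.map (X i) = μ) (hYμ : ∀ i, P.map (Y i) = μ)
    (hind : iIndepFun (Sum.elim X Y) P) :
    ∀ᵐ s ∂P, ∀ r : ℝ, 0 < r → ENNReal.ofReal (Real.exp (-(κ * r ^ d))) ≤
      liminf (fun n : ℕ => ENNReal.ofReal (farCount (fun i => X i s) (fun i => Y i s) n n
        (r * (n : ℝ) ^ (-(1 / d : ℝ))) / n)) atTop := by
  -- Rational radii and levels give one null set that serves all real `r`.
  have hae : ∀ᵐ s ∂P, ∀ r c : ℚ, (0 : ℝ) < r → (0 : ℝ) ≤ c → (c : ℝ) < Real.exp (-(κ * r ^ d)) →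
      ∀ᶠ n : ℕ in atTop, (c : ℝ) * n <
        farCount (fun i => X i s) (fun i => Y i s) n n (r * (n : ℝ) ^ (-(1 / d : ℝ))) := by
    simp only [ae_all_iff, eventually_imp_distrib_left]
    exact fun r c hr hc0 hc => ae_eventually_lt_farCount hd hκ hμ hX hY hXμ hYμ hind hr hc0 hc
  filter_upwards [hae] with s hs r hr
  refine le_of_forall_lt fun b hb => ?_
  have hbt : b ≠ ∞ := hb.ne_top
  have hb' : b.toReal < Real.exp (-(κ * r ^ d)) := (ENNReal.lt_ofReal_iff_toReal_lt hbt).1 hb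
  obtain ⟨c, hbc, hc⟩ := exists_rat_btwn hb'
  have hc0 : (0 : ℝ) ≤ c := ENNReal.toReal_nonneg.trans hbc.le
  have hcont : Continuous fun t : ℝ => Real.exp (-(κ * t ^ d)) := by fun_prop
  have hnear : ∀ᶠ t in 𝓝 r, (c : ℝ) < Real.exp (-(κ * t ^ d)) :=
    hcont.continuousAt.eventually_const_lt hc
  -- A rational radius `q` slightly above `r` still satisfies the strict bound, and its count is at
  -- most the count at `r`.
  obtain ⟨u, hu, hur⟩ := exists_Ico_subset_of_mem_nhds hnear ⟨r + 1, by linarith⟩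
  obtain ⟨q, hq1, hq2⟩ := exists_rat_btwn hu
  have hcq : (c : ℝ) < Real.exp (-(κ * q ^ d)) := hur ⟨hq1.le, hq2⟩
  refine lt_of_lt_of_le ((ENNReal.lt_ofReal_iff_toReal_lt hbt).2 hbc)
    (le_liminf_of_le (by isBoundedDefault) ?_)
  filter_upwards [hs q c (hr.trans hq1) hc0 hcq, eventually_gt_atTop 0] with n hn hn0
  have hn' : (0 : ℝ) < n := by exact_mod_cast hn0
  refine ENNReal.ofReal_le_ofReal ((le_div_iff₀ hn').2 (hn.le.trans ?_))
  exact_mod_cast farCount_mono _ _ le_rfl le_rfl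
    (mul_le_mul_of_nonneg_right hq1.le (by positivity))

end AlmostSure

/-! ### Layer-cake formula, Gamma integral and Fatou's lemma -/

theorem lintegral_mul_rpow_indicator_Iio {p t : ℝ} (hp : 0 < p) (ht : 0 ≤ t) :
    ∫⁻ r in Set.Ioi 0, ENNReal.ofReal (p * r ^ (p - 1)) * (Set.Iio t).indicator 1 r =
      ENNReal.ofReal (t ^ p) := by
  have h1 : ∀ r, ENNReal.ofReal (p * r ^ (p - 1)) * (Set.Iio t).indicator 1 r =
      (Set.Iio t).indicator (fun r => ENNReal.ofReal (p * r ^ (p - 1))) r := by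
    intro r
    by_cases hr : r ∈ Set.Iio t <;> simp [hr]
  simp only [h1]
  rw [setLIntegral_indicator measurableSet_Iio, Set.Iio_inter_Ioi,
    restrict_Ioo_eq_restrict_Ioc, ← ofReal_integral_eq_lintegral_ofReal,
    ← intervalIntegral.integral_of_le ht, intervalIntegral.integral_const_mul,
    integral_rpow (Or.inl (by linarith))]
  · congr 1
    rw [sub_add_cancel, Real.zero_rpow hp.ne']
    field_simp
    simp
  · rw [← IntegrableOn, ← intervalIntegrable_iff_integrableOn_Ioc_of_le ht]
    exact (intervalIntegral.intervalIntegrable_rpow' (by linarith)).const_mul p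
  · refine (ae_restrict_iff' measurableSet_Ioc).2 (ae_of_all _ fun r hr => ?_)
    have := hr.1
    simp only [Pi.zero_apply]
    positivity

theorem lintegral_mul_rpow_mul_exp {d : ℕ} (hd : d ≠ 0) {p κ : ℝ} (hp : 0 < p) (hκ : 0 < κ) :
    ∫⁻ r in Set.Ioi 0, ENNReal.ofReal (p * r ^ (p - 1)) *
        ENNReal.ofReal (Real.exp (-(κ * r ^ d))) =
      ENNReal.ofReal (κ ^ (-(p / d)) * Real.Gamma (1 + p / d)) := by
  have hd' : (0 : ℝ) < d := by positivity
  have hint := integral_rpow_mul_exp_neg_mul_rpow (p := d) (q := p - 1) hd' (by linarith) hκ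
  have hval : κ ^ (-(p / d)) * Real.Gamma (1 + p / d) =
      ∫ r in Set.Ioi 0, p * (r ^ (p - 1) * Real.exp (-κ * r ^ (d : ℝ))) := by
    rw [integral_const_mul, hint, add_comm 1, Real.Gamma_add_one (by positivity), sub_add_cancel,
      neg_div]
    field_simp
  have hpos : 0 < ∫ r in Set.Ioi 0, p * (r ^ (p - 1) * Real.exp (-κ * r ^ (d : ℝ))) := by
    rw [← hval]
    exact mul_pos (by positivity) (Real.Gamma_pos_of_pos (by positivity))
  rw [hval, ofReal_integral_eq_lintegral_ofReal]
  · refine setLIntegral_congr_fun measurableSet_Ioi fun r hr => ?_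
    have : 0 < r := hr
    rw [← ENNReal.ofReal_mul (by positivity), Real.rpow_natCast, neg_mul, mul_assoc]
  -- A non-integrable function would have Bochner integral `0`.
  · exact Integrable.of_integral_ne_zero hpos.ne'
  · refine (ae_restrict_iff' measurableSet_Ioi).2 (ae_of_all _ fun r hr => ?_)
    have : 0 < r := hr
    simp only [Pi.zero_apply]
    positivity

/-- Splitting `n ^ (p / d - 1)` as `(1 / n) * (n ^ (1 / d)) ^ p` turns the cost into an average of
rescaled distances. -/
theorem exists_perm_scaledMatchingCost_eq_sum {d : ℕ} (p : ℝ) {n : ℕ} (hn : 0 < n)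
    (x y : ℕ → EuclideanSpace ℝ (Fin d)) : ∃ π : Equiv.Perm (Fin n),
      scaledMatchingCost p n x y =
        ∑ i : Fin n, (1 / n : ℝ) * ((n : ℝ) ^ (1 / d : ℝ) * dist (x i) (y (π i))) ^ p := by
  obtain ⟨π, hπ⟩ := exists_eq_ciInf_of_finite
    (f := fun π : Equiv.Perm (Fin n) => ∑ i : Fin n, dist (x i) (y (π i)) ^ p)
  refine ⟨π, ?_⟩
  have hn' : (0 : ℝ) < n := by exact_mod_cast hn
  rw [scaledMatchingCost, matchingCost, ← hπ, Finset.mul_sum]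
  refine Finset.sum_congr rfl fun i _ => ?_
  rw [Real.mul_rpow (by positivity) dist_nonneg, ← Real.rpow_mul hn'.le, Real.rpow_sub_one hn'.ne']
  ring_nf

/-- A point far from every `Y j` is in particular far from its optimal partner; the layer-cake
formula is then applied to each rescaled distance. -/
theorem lintegral_farCount_le_scaledMatchingCost {d : ℕ} {p : ℝ} (hp : 0 < p) {n : ℕ}
    (hn : 0 < n) (x y : ℕ → EuclideanSpace ℝ (Fin d)) :
    ∫⁻ r in Set.Ioi 0, ENNReal.ofReal (p * r ^ (p - 1)) *
        ENNReal.ofReal (farCount x y n n (r * (n : ℝ) ^ (-(1 / d : ℝ))) / n) ≤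
      ENNReal.ofReal (scaledMatchingCost p n x y) := by
  classical
  obtain ⟨π, hπ⟩ := exists_perm_scaledMatchingCost_eq_sum p hn x y
  have hn' : (0 : ℝ) < n := by exact_mod_cast hn
  set t : Fin n → ℝ := fun i => (n : ℝ) ^ (1 / d : ℝ) * dist (x i) (y (π i)) with ht
  have ht0 : ∀ i, 0 ≤ t i := fun i => by positivity
  have hcount : ∀ r : ℝ, (farCount x y n n (r * (n : ℝ) ^ (-(1 / d : ℝ))) : ℝ) / n ≤
      ∑ i, (1 / n : ℝ) * (Set.Iio (t i)).indicator 1 r := by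
    intro r
    have h1 : (farCount x y n n (r * (n : ℝ) ^ (-(1 / d : ℝ))) : ℝ) =
        ∑ i : Fin n, if ∀ j : Fin n, r * (n : ℝ) ^ (-(1 / d : ℝ)) < dist (x i) (y j)
          then (1 : ℝ) else 0 := by
      rw [Fin.sum_univ_eq_sum_range (fun i => if ∀ j : Fin n,
        r * (n : ℝ) ^ (-(1 / d : ℝ)) < dist (x i) (y j) then (1 : ℝ) else 0), Finset.sum_boole]
      rw [farCount]
    rw [h1, ← Finset.mul_sum, div_eq_inv_mul, one_div (n : ℝ)]
    refine mul_le_mul_of_nonneg_left (Finset.sum_le_sum fun i _ => ?_) (by positivity)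
    split_ifs with h
    · have h2 := h (π i)
      rw [Real.rpow_neg hn'.le, ← div_eq_mul_inv, div_lt_iff₀' (by positivity)] at h2
      rw [Set.indicator_of_mem (show r ∈ Set.Iio (t i) from h2)]
      simp
    · exact Set.indicator_nonneg (by simp) _
  have hterm : ∀ i, ENNReal.ofReal ((1 / n : ℝ) * t i ^ p) = ∫⁻ r in Set.Ioi 0,
      ENNReal.ofReal (p * r ^ (p - 1)) *
        ENNReal.ofReal ((1 / n : ℝ) * (Set.Iio (t i)).indicator 1 r) := by
    intro i
    rw [ENNReal.ofReal_mul (by positivity), ← lintegral_mul_rpow_indicator_Iio hp (ht0 i),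
      ← lintegral_const_mul' _ _ ENNReal.ofReal_ne_top]
    refine lintegral_congr fun r => ?_
    rw [ENNReal.ofReal_mul (by positivity : (0 : ℝ) ≤ 1 / n)]
    by_cases hr : r ∈ Set.Iio (t i) <;> simp [hr, mul_comm]
  have hmeas : ∀ i, Measurable fun r => ENNReal.ofReal (p * r ^ (p - 1)) *
        ENNReal.ofReal ((1 / n : ℝ) * (Set.Iio (t i)).indicator 1 r) := by
    intro i
    have : Measurable ((Set.Iio (t i)).indicator (1 : ℝ → ℝ)) :=
      measurable_one.indicator measurableSet_Iio
    fun_prop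
  rw [hπ, ENNReal.ofReal_sum_of_nonneg fun i _ => by positivity]
  change _ ≤ ∑ i, ENNReal.ofReal ((1 / n : ℝ) * t i ^ p)
  simp only [hterm]
  rw [← lintegral_finsetSum _ fun i _ => hmeas i]
  refine lintegral_mono fun r => ?_
  rw [← Finset.mul_sum, ← ENNReal.ofReal_sum_of_nonneg]
  · gcongr
    exact hcount r
  · exact fun i _ => mul_nonneg (by positivity) (Set.indicator_nonneg (by simp) _)

theorem le_liminf_scaledMatchingCost {d : ℕ} (hd : d ≠ 0) {p κ : ℝ} (hp : 0 < p) (hκ : 0 < κ)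
    {x y : ℕ → EuclideanSpace ℝ (Fin d)}
    (h : ∀ r : ℝ, 0 < r → ENNReal.ofReal (Real.exp (-(κ * r ^ d))) ≤
      liminf (fun n : ℕ => ENNReal.ofReal (farCount x y n n
        (r * (n : ℝ) ^ (-(1 / d : ℝ))) / n)) atTop) :
    ENNReal.ofReal (κ ^ (-(p / d)) * Real.Gamma (1 + p / d)) ≤
      liminf (fun n : ℕ => ENNReal.ofReal (scaledMatchingCost p n x y)) atTop := by
  have hmeas : ∀ n : ℕ, Measurable fun r : ℝ => ENNReal.ofReal (p * r ^ (p - 1)) *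
      ENNReal.ofReal (farCount x y n n (r * (n : ℝ) ^ (-(1 / d : ℝ))) / n) := by
    intro n
    -- Monotonicity in `r` supplies the measurability that Fatou's lemma requires.
    have : Antitone fun r : ℝ =>
        ENNReal.ofReal (farCount x y n n (r * (n : ℝ) ^ (-(1 / d : ℝ))) / n) := by
      intro r r' hrr
      refine ENNReal.ofReal_le_ofReal (div_le_div_of_nonneg_right ?_ (by positivity))
      exact_mod_cast farCount_mono _ _ le_rfl le_rfl
        (mul_le_mul_of_nonneg_right hrr (by positivity))
    exact Measurable.mul (by fun_prop) this.measurable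
  calc ENNReal.ofReal (κ ^ (-(p / d)) * Real.Gamma (1 + p / d))
      = ∫⁻ r in Set.Ioi 0, ENNReal.ofReal (p * r ^ (p - 1)) *
          ENNReal.ofReal (Real.exp (-(κ * r ^ d))) := (lintegral_mul_rpow_mul_exp hd hp hκ).symm
    _ ≤ ∫⁻ r in Set.Ioi 0, liminf (fun n : ℕ => ENNReal.ofReal (p * r ^ (p - 1)) *
          ENNReal.ofReal (farCount x y n n (r * (n : ℝ) ^ (-(1 / d : ℝ))) / n)) atTop := by
        refine setLIntegral_mono' measurableSet_Ioi fun r hr => ?_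
        rw [ENNReal.liminf_const_mul_of_ne_top ENNReal.ofReal_ne_top]
        gcongr
        exact h r hr
    _ ≤ liminf (fun n : ℕ => ∫⁻ r in Set.Ioi 0, ENNReal.ofReal (p * r ^ (p - 1)) *
          ENNReal.ofReal (farCount x y n n (r * (n : ℝ) ^ (-(1 / d : ℝ))) / n)) atTop :=
        lintegral_liminf_le hmeas
    _ ≤ _ := by
        refine liminf_le_liminf ?_
        filter_upwards [eventually_gt_atTop 0] with n hn
        exact lintegral_farCount_le_scaledMatchingCost hp hn x y

/-! ### Uniform samples on a domain -/

section UniformSample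

variable {d : ℕ} {S : Type*} [MeasurableSpace S] {P : Measure S} [IsProbabilityMeasure P]

/-- Boundary effects only help: cutting the ball with `Ω` lowers its mass, so no regularity of the
boundary is needed. -/
theorem cond_volume_closedBall_le {Ω : Set (EuclideanSpace ℝ (Fin d))} (hΩ : MeasurableSet Ω)
    (x : EuclideanSpace ℝ (Fin d)) {ρ : ℝ} (hρ : 0 ≤ ρ) :
    (cond volume Ω).real (Metric.closedBall x ρ) ≤
      volume.real (Metric.ball (0 : EuclideanSpace ℝ (Fin d)) 1) / volume.real Ω * ρ ^ d := by
  have h : volume.real (Ω ∩ Metric.closedBall x ρ) ≤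
      ρ ^ d * volume.real (Metric.ball (0 : EuclideanSpace ℝ (Fin d)) 1) := by
    refine (measureReal_mono Set.inter_subset_right measure_closedBall_lt_top.ne).trans_eq ?_
    rw [measureReal_def, Measure.addHaar_closedBall _ _ hρ, ENNReal.toReal_mul,
      ENNReal.toReal_ofReal (by positivity), finrank_euclideanSpace_fin, measureReal_def]
  rw [measureReal_def, cond_apply hΩ, ENNReal.toReal_mul, ENNReal.toReal_inv,
    ← measureReal_def, ← measureReal_def]
  calc _ ≤ (volume.real Ω)⁻¹ *
        (ρ ^ d * volume.real (Metric.ball (0 : EuclideanSpace ℝ (Fin d)) 1)) := by gcongr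
    _ = _ := by ring

/-- The nearest-neighbour lower bound for the matching cost of uniform samples. -/
theorem ae_le_liminf_scaledMatchingCost (hd : d ≠ 0) {p : ℝ} (hp : 0 < p)
    {Ω : Set (EuclideanSpace ℝ (Fin d))} (hΩ : MeasurableSet Ω) (hΩ0 : volume Ω ≠ 0)
    (hΩt : volume Ω ≠ ∞) {X Y : ℕ → S → EuclideanSpace ℝ (Fin d)}
    (hX : ∀ i, Measurable (X i)) (hY : ∀ i, Measurable (Y i))
    (hXΩ : ∀ i, P.map (X i) = cond volume Ω) (hYΩ : ∀ i, P.map (Y i) = cond volume Ω)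
    (hind : iIndepFun (Sum.elim X Y) P) :
    ∀ᵐ s ∂P, ENNReal.ofReal
        ((volume.real (Metric.ball (0 : EuclideanSpace ℝ (Fin d)) 1)) ^ (-(p / d)) *
          Real.Gamma (1 + p / d) * volume.real Ω ^ (p / d)) ≤
      liminf (fun n : ℕ => ENNReal.ofReal
        (scaledMatchingCost p n (fun i => X i s) (fun i => Y i s))) atTop := by
  have : IsProbabilityMeasure (cond volume Ω) := cond_isProbabilityMeasure_of_finite hΩ0 hΩt
  have hω : 0 < volume.real (Metric.ball (0 : EuclideanSpace ℝ (Fin d)) 1) :=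
    ENNReal.toReal_pos (Metric.measure_ball_pos _ _ one_pos).ne' measure_ball_lt_top.ne
  have hv : 0 < volume.real Ω := ENNReal.toReal_pos hΩ0 hΩt
  have hκ := div_pos hω hv
  filter_upwards [ae_le_liminf_farCount_div hd hκ.le
    (fun x ρ hρ => cond_volume_closedBall_le hΩ x hρ) hX hY hXΩ hYΩ hind] with s hs
  have h := le_liminf_scaledMatchingCost hd hp hκ hs
  rw [Real.div_rpow hω.le hv.le, Real.rpow_neg hv.le, div_inv_eq_mul, mul_right_comm] at h
  exact h

end UniformSample

/-! ### The cube model and the final bounds -/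

theorem measurableSet_unitCube (d : ℕ) : MeasurableSet (unitCube d) := by
  have : unitCube d = ⋂ i, (fun x : EuclideanSpace ℝ (Fin d) => x i) ⁻¹' Set.Icc 0 1 := by
    ext x; simp [unitCube]
  rw [this]
  exact MeasurableSet.iInter fun i => measurableSet_Icc.preimage (by fun_prop)

theorem iIndepFun_cubeSampleLaw (d : ℕ) :
    iIndepFun (Sum.elim (fun i (ω : ℕ ⊕ ℕ → EuclideanSpace ℝ (Fin d)) => ω (Sum.inl i))
      (fun i ω => ω (Sum.inr i))) (cubeSampleLaw d) := by
  have h := iIndepFun_infinitePi (P := fun _ : ℕ ⊕ ℕ => cubeUniform d)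
    (X := fun _ x => x) fun _ => measurable_id
  have he : (Sum.elim (fun i (ω : ℕ ⊕ ℕ → EuclideanSpace ℝ (Fin d)) => ω (Sum.inl i))
      (fun i ω => ω (Sum.inr i))) = fun k ω => ω k := by
    ext (k | k) <;> rfl
  rw [he]
  exact h

theorem map_eval_cubeSampleLaw (d : ℕ) (k : ℕ ⊕ ℕ) :
    (cubeSampleLaw d).map (fun ω => ω k) = cond volume (unitCube d) :=
  Measure.infinitePi_map_eval (fun _ : ℕ ⊕ ℕ => cubeUniform d) k

theorem proposition2 (d : ℕ) (p : ℝ) (hp : 0 < p) (hpd : p < (d : ℝ) / 2) :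
    -- the constant itself, without presupposing that the limit exists
    ENNReal.ofReal
        ((volume.real (Metric.ball (0 : EuclideanSpace ℝ (Fin d)) 1)) ^ (-(p / d)) *
          Real.Gamma (1 + p / d))
      ≤ bipartiteConstant d p ∧
    -- any number that is the constant in the limit theorem on some bounded domain
    ∀ (Ω : Set (EuclideanSpace ℝ (Fin d))), Bornology.IsBounded Ω → MeasurableSet Ω →
      0 < volume Ω →
    ∀ (S : Type*) [MeasurableSpace S] (P : Measure S) [IsProbabilityMeasure P]
      (X Y : ℕ → S → EuclideanSpace ℝ (Fin d)),
      (∀ i, Measurable (X i)) → (∀ i, Measurable (Y i)) →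
      (∀ i, pdf.IsUniform (X i) Ω P volume) → (∀ i, pdf.IsUniform (Y i) Ω P volume) →
      iIndepFun (Sum.elim X Y) P →
    ∀ β : ℝ,
      (∀ᵐ s ∂P, Tendsto (fun n : ℕ =>
        scaledMatchingCost p n (fun i => X i s) (fun i => Y i s)) atTop
          (𝓝 (β * (volume.real Ω) ^ (p / d)))) →
      (volume.real (Metric.ball (0 : EuclideanSpace ℝ (Fin d)) 1)) ^ (-(p / d)) *
          Real.Gamma (1 + p / d) ≤ β := by
  -- The upper bound on `p` enters only here, to force positive dimension.
  have hd : d ≠ 0 := by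
    rintro rfl
    simp at hpd
    linarith
  refine ⟨?_, ?_⟩
  · have : IsProbabilityMeasure (cubeSampleLaw d) := by
      unfold cubeSampleLaw; infer_instance
    have h := ae_le_liminf_scaledMatchingCost hd hp (measurableSet_unitCube d)
      (by simp [volume_unitCube]) (by simp [volume_unitCube])
      (fun i => measurable_pi_apply (Sum.inl i)) (fun i => measurable_pi_apply (Sum.inr i))
      (fun i => map_eval_cubeSampleLaw d (Sum.inl i))
      (fun i => map_eval_cubeSampleLaw d (Sum.inr i)) (iIndepFun_cubeSampleLaw d)
    rw [measureReal_def volume (unitCube d), volume_unitCube, ENNReal.toReal_one, Real.one_rpow, mul_one] at h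
    exact le_essInf_of_ae_le _ h
  · intro Ω hΩb hΩ hΩ0 S _ P _ X Y hX hY hXΩ hYΩ hind β hβ
    have hΩt : volume Ω ≠ ∞ := hΩb.measure_lt_top.ne
    have hv : 0 < volume.real Ω := ENNReal.toReal_pos hΩ0.ne' hΩt
    -- Since `β` is deterministic, a single sample point in both almost sure events suffices.
    obtain ⟨s, hs, hlim⟩ := ((ae_le_liminf_scaledMatchingCost hd hp hΩ hΩ0.ne' hΩt hX hY
      hXΩ hYΩ hind).and hβ).exists
    rw [(ENNReal.tendsto_ofReal hlim).liminf_eq] at hs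
    have hω : 0 < volume.real (Metric.ball (0 : EuclideanSpace ℝ (Fin d)) 1) :=
      ENNReal.toReal_pos (Metric.measure_ball_pos _ _ one_pos).ne' measure_ball_lt_top.ne
    have hΓ : 0 < Real.Gamma (1 + p / d) := Real.Gamma_pos_of_pos (by positivity)
    -- Truncation by `ENNReal.ofReal` leaves the alternative that the left side is nonpositive,
    -- excluded by positivity of the constant.
    have h := (ENNReal.ofReal_le_ofReal_iff' .. |>.1 hs).resolve_right (by
      exact not_le.2 (by positivity))
    exact le_of_mul_le_mul_right h (by positivity)
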